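/- Let $\tau(n)=\sum_{d\mid n}1$ be the divisor function and $e(\alpha)=e^{2\pi i\alpha}$. For real $X$ put $$M_\tau(\alpha)=\sum_{1\le n\le X}\tau(n)\,e(n\alpha).$$ For every real $p>2$ there are constants $c,C>0$, depending only on $p$, such that for all real $X\ge 2$ $$c\,X^{p-1}(\log X)^p\le\int_0^1|M_\tau(\alpha)|^p\,d\alpha\le C\,X^{p-1}(\log X)^p.$$ -/

import Mathlib

noncomputable section

/-- The additive character `e(α) = exp(2πiα)` of the real line. -/
def e (α : ℝ) : ℂ :=
  Complex.exp (2 * (Real.pi : ℂ) * Complex.I * (α : ℂ))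

/-- The divisor function `τ(n)`, the number of positive divisors of `n`. -/
def tau (n : ℕ) : ℕ :=
  ∑ _d ∈ n.divisors, 1

/-- The exponential sum `M_f(α) = ∑_{1 ≤ n ≤ X} f(n) e(nα)`, for real `X`. -/
def expSum (f : ℕ → ℂ) (X α : ℝ) : ℂ :=
  ∑ n ∈ Finset.Icc 1 ⌊X⌋₊, f n * e ((n : ℝ) * α)

/-- The moment `I_f(p) = ∫₀¹ |M_f(α)|^p dα` of the sum of length `X`. -/
def moment (f : ℕ → ℂ) (X p : ℝ) : ℝ :=
  ∫ α in (0 : ℝ)..1, ‖expSum f X α‖ ^ p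

end

/-! Both bounds come from the peaks of `M_τ` at rationals. On `[0, 1/(6X)]` the terms do not cancel,
so `|M_τ| ≫ X log X` there, and this interval alone gives the lower bound (`le_moment_tau`).

For the upper bound put `Y = ⌊X⌋`. The hyperbola method splits `M_τ` into geometric sums of
frequency `aα` with `a ≤ √Y`. When `α` is close to `a₀/q`, the `a` divisible by `q` produce a peak
of size `Y log X / (q(1 + Y|α - a₀/q|))`, and the other `a` contribute only `O(√Y log X)`
(`norm_expSum_tau_le_of_near`). Dirichlet approximation supplies such a fraction with `q ≤ 2√Y` for
every `α`. The `p`-th power of one peak integrates to `O(X^(p-1) q^(-p) (log X)^p)`; with at most `q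
+ 1` numerators for each `q`, the total is governed by `∑ q^(1-p)`, which converges because `p > 2`
(`moment_tau_le`). -/

/-! ### The additive character and geometric sums. -/

theorem e_eq_exp (x : ℝ) : e x = Complex.exp (Complex.I * ((2 * Real.pi * x : ℝ) : ℂ)) := by
  unfold e
  congr 1
  push_cast
  ring

theorem norm_e (x : ℝ) : ‖e x‖ = 1 := by
  rw [e_eq_exp, mul_comm, Complex.norm_exp_ofReal_mul_I]

theorem e_natCast_mul (n : ℕ) (x : ℝ) : e ((n : ℝ) * x) = e x ^ n := by
  unfold e
  rw [← Complex.exp_nat_mul]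
  congr 1
  push_cast
  ring

theorem e_sub_intCast (x : ℝ) (k : ℤ) : e (x - k) = e x := by
  unfold e
  rw [Complex.exp_eq_exp_iff_exists_int]
  refine ⟨-k, ?_⟩
  push_cast
  ring

theorem continuous_e : Continuous e := by
  unfold e
  fun_prop

theorem four_mul_abs_le_norm_e_sub_one {x : ℝ} (hx : |x| ≤ 1 / 2) : 4 * |x| ≤ ‖e x - 1‖ := by
  have hpi := Real.pi_pos
  rw [e_eq_exp, Complex.norm_exp_I_mul_ofReal_sub_one, norm_mul, Real.norm_eq_abs,
    Real.norm_eq_abs]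
  have h : 2 * Real.pi * x / 2 = Real.pi * x := by ring
  have hle : |Real.pi * x| ≤ Real.pi / 2 := by
    rw [abs_mul, abs_of_pos hpi]
    nlinarith
  have hs : |Real.sin (Real.pi * x)| = Real.sin |Real.pi * x| := by
    rcases abs_cases (Real.pi * x) with ⟨h1, h2⟩ | ⟨h1, h2⟩
    · rw [h1, abs_of_nonneg]
      exact Real.sin_nonneg_of_nonneg_of_le_pi h2 (by linarith)
    · rw [h1, Real.sin_neg, abs_of_nonpos]
      exact Real.sin_nonpos_of_nonpos_of_neg_pi_le h2.le (by linarith)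
  have hm := Real.mul_le_sin (abs_nonneg (Real.pi * x)) hle
  have h3 : 2 / Real.pi * |Real.pi * x| = 2 * |x| := by
    rw [abs_mul, abs_of_pos hpi]
    field_simp
  rw [h, hs, abs_of_pos (by norm_num : (0 : ℝ) < 2)]
  linarith

/-- A geometric sum of `e(bθ)` is bounded by the inverse distance from `θ` to an integer. -/
theorem norm_sum_Ico_e_mul_abs_le (m n : ℕ) (θ : ℝ) (k : ℤ) (hk : |θ - k| ≤ 1 / 2) :
    ‖∑ b ∈ Finset.Ico m n, e ((b : ℝ) * θ)‖ * |θ - k| ≤ 1 / 2 := by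
  rcases le_total n m with h | h
  · simp [Finset.Ico_eq_empty_of_le h]
  have h1 := four_mul_abs_le_norm_e_sub_one hk
  rw [e_sub_intCast] at h1
  have h2 : (∑ b ∈ Finset.Ico m n, e ((b : ℝ) * θ)) * (e θ - 1) =
      e ((n : ℝ) * θ) - e ((m : ℝ) * θ) := by
    simp only [e_natCast_mul]
    exact geom_sum_Ico_mul _ h
  have h3 : ‖∑ b ∈ Finset.Ico m n, e ((b : ℝ) * θ)‖ * ‖e θ - 1‖ ≤ 2 := by
    rw [← norm_mul, h2]
    refine (norm_sub_le _ _).trans ?_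
    rw [norm_e, norm_e]
    norm_num
  have h4 := mul_le_mul_of_nonneg_left h1
    (norm_nonneg (∑ b ∈ Finset.Ico m n, e ((b : ℝ) * θ)))
  linarith

theorem norm_sum_Ico_e_le {m : ℕ} (hm : 1 ≤ m) (n : ℕ) (θ : ℝ) :
    ‖∑ b ∈ Finset.Ico m (n + 1), e ((b : ℝ) * θ)‖ ≤ n := by
  refine (norm_sum_le _ _).trans ?_
  simp only [norm_e, Finset.sum_const, Nat.card_Ico, nsmul_eq_mul, mul_one]
  exact_mod_cast (by omega : n + 1 - m ≤ n)

/-! ### Divisor sums and the hyperbola method. -/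

theorem sum_tau_mul {R : Type*} [CommSemiring R] (F : ℕ → R) (Y : ℕ) :
    ∑ n ∈ Finset.Icc 1 Y, (tau n : R) * F n =
      ∑ a ∈ Finset.Ioc 0 Y, ∑ b ∈ Finset.Ico 1 (Y / a + 1), F (b * a) := by
  have h : ∀ n, (tau n : R) * F n = ∑ _d ∈ n.divisors, F n := by
    intro n
    simp [tau]
  simp only [h]
  rw [Finset.sum_sigma', Finset.sum_sigma']
  refine Finset.sum_bij' (fun x _ => ⟨x.2, x.1 / x.2⟩) (fun x _ => ⟨x.2 * x.1, x.1⟩) ?_ ?_ ?_ ?_ ?_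
  · rintro ⟨n, d⟩ hx
    simp only [Finset.mem_sigma, Finset.mem_Icc, Nat.mem_divisors, Finset.mem_Ioc,
      Finset.mem_Ico] at hx ⊢
    obtain ⟨⟨h1, h2⟩, h3, h4⟩ := hx
    have hd := Nat.pos_of_dvd_of_pos h3 h1
    have hle := Nat.le_of_dvd h1 h3
    exact ⟨⟨hd, by omega⟩, Nat.div_pos hle hd, Nat.lt_succ_of_le (Nat.div_le_div_right h2)⟩
  · rintro ⟨a, b⟩ hx
    simp only [Finset.mem_sigma, Finset.mem_Icc, Nat.mem_divisors, Finset.mem_Ioc,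
      Finset.mem_Ico] at hx ⊢
    obtain ⟨⟨h1, h2⟩, h3, h4⟩ := hx
    have h5 := (Nat.le_div_iff_mul_le h1).1 (Nat.le_of_lt_succ h4)
    have h6 : 0 < b * a := Nat.mul_pos h3 h1
    exact ⟨⟨h6, h5⟩, Dvd.intro_left _ rfl, h6.ne'⟩
  · rintro ⟨n, d⟩ hx
    simp only [Finset.mem_sigma, Nat.mem_divisors] at hx
    simp [Nat.div_mul_cancel hx.2.1]
  · rintro ⟨a, b⟩ hx
    simp only [Finset.mem_sigma, Finset.mem_Ioc] at hx
    simp [Nat.mul_div_cancel _ hx.1.1]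
  · rintro ⟨n, d⟩ hx
    simp only [Finset.mem_sigma, Nat.mem_divisors] at hx
    simp [Nat.div_mul_cancel hx.2.1]

/-- The Dirichlet hyperbola method. -/
theorem sum_hyperbola {R : Type*} [CommSemiring R] (F : ℕ → R) (Y : ℕ) :
    ∑ a ∈ Finset.Ioc 0 Y, ∑ b ∈ Finset.Ico 1 (Y / a + 1), F (b * a) =
      ∑ a ∈ Finset.Ioc 0 Y.sqrt, ∑ b ∈ Finset.Ico 1 (Y / a + 1), F (b * a) +
      ∑ a ∈ Finset.Ioc 0 Y.sqrt, ∑ b ∈ Finset.Ico (Y.sqrt + 1) (Y / a + 1), F (b * a) := by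
  rw [← Finset.Ioc_union_Ioc_eq_Ioc (Nat.zero_le _) (Nat.sqrt_le_self Y),
    Finset.sum_union (by
      rw [Finset.disjoint_left]
      intro a ha hb
      simp only [Finset.mem_Ioc] at ha hb
      omega)]
  congr 1
  rw [Finset.sum_comm' (s' := fun b => Finset.Ico (Y.sqrt + 1) (Y / b + 1))
    (t' := Finset.Ioc 0 Y.sqrt)]
  · simp only [mul_comm]
  · intro a b
    simp only [Finset.mem_Ioc, Finset.mem_Ico]
    constructor
    · rintro ⟨⟨h1, h2⟩, h3, h4⟩
      have h5 := (Nat.le_div_iff_mul_le (by omega : 0 < a)).1 (Nat.le_of_lt_succ h4)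
      refine ⟨⟨h1, Nat.lt_succ_of_le ((Nat.le_div_iff_mul_le h3).2 (by rwa [mul_comm]))⟩, h3, ?_⟩
      by_contra! h6
      have h7 := Nat.lt_succ_sqrt Y
      have h8 := Nat.mul_le_mul (Nat.succ_le_of_lt h6) (Nat.succ_le_of_lt h1)
      omega
    · rintro ⟨⟨h1, h2⟩, h3, h4⟩
      have h5 := (Nat.le_div_iff_mul_le h3).1 (Nat.le_of_lt_succ h2)
      refine ⟨⟨h1, (Nat.le_mul_of_pos_right a h3).trans h5⟩, h3, Nat.lt_succ_of_le
        ((Nat.le_div_iff_mul_le (by omega)).2 (by rwa [mul_comm]))⟩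

/-- The bound must be uniform in the lower endpoint `m`: the two halves of the hyperbola sum start
at `b = 1` and at `b = √Y + 1`. They share the majorant, whence the factor 2. -/
theorem norm_expSum_tau_le {X α : ℝ} {B : ℕ → ℝ}
    (hB : ∀ a ∈ Finset.Ioc 0 ⌊X⌋₊.sqrt, ∀ m, 1 ≤ m →
      ‖∑ b ∈ Finset.Ico m (⌊X⌋₊ / a + 1), e ((b : ℝ) * (a * α))‖ ≤ B a) :
    ‖expSum (fun n => (tau n : ℂ)) X α‖ ≤ 2 * ∑ a ∈ Finset.Ioc 0 ⌊X⌋₊.sqrt, B a := by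
  have key : ∀ m, 1 ≤ m → ‖∑ a ∈ Finset.Ioc 0 ⌊X⌋₊.sqrt,
      ∑ b ∈ Finset.Ico m (⌊X⌋₊ / a + 1), e (((b * a : ℕ) : ℝ) * α)‖ ≤
      ∑ a ∈ Finset.Ioc 0 ⌊X⌋₊.sqrt, B a := by
    intro m hm
    refine (norm_sum_le _ _).trans (Finset.sum_le_sum fun a ha => ?_)
    simpa only [Nat.cast_mul, mul_assoc] using hB a ha m hm
  unfold expSum
  rw [sum_tau_mul (fun n => e ((n : ℝ) * α)), sum_hyperbola (fun n => e ((n : ℝ) * α)), two_mul]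
  exact (norm_add_le _ _).trans (add_le_add (key _ le_rfl) (key _ (by omega)))

/-! ### Harmonic sums, residues and the bound near a fraction. -/

theorem sum_Icc_inv_le (n : ℕ) : ∑ k ∈ Finset.Icc 1 n, ((k : ℝ))⁻¹ ≤ 1 + Real.log n := by
  have h := harmonic_le_one_add_log n
  rw [harmonic_eq_sum_Icc] at h
  push_cast at h
  exact h

theorem log_le_sum_Icc_inv {x : ℝ} (hx : 0 < x) :
    Real.log x ≤ ∑ k ∈ Finset.Icc 1 ⌊x⌋₊, ((k : ℝ))⁻¹ := by
  have h := log_add_one_le_harmonic ⌊x⌋₊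
  rw [harmonic_eq_sum_Icc] at h
  push_cast at h
  exact (Real.log_le_log hx (Nat.lt_floor_add_one x).le).trans h

theorem sum_multiples_inv_le {q : ℕ} (hq : 0 < q) (r : ℕ) :
    ∑ a ∈ (Finset.Ioc 0 r).filter (q ∣ ·), ((a : ℝ))⁻¹ ≤ (q : ℝ)⁻¹ * (1 + Real.log r) := by
  have h : ∑ a ∈ (Finset.Ioc 0 r).filter (q ∣ ·), ((a : ℝ))⁻¹ ≤
      ∑ a ∈ (Finset.Icc 1 r).image (q * ·), ((a : ℝ))⁻¹ := by
    refine Finset.sum_le_sum_of_subset_of_nonneg ?_ fun _ _ _ => by positivity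
    intro a ha
    simp only [Finset.mem_filter, Finset.mem_Ioc] at ha
    obtain ⟨⟨h1, h2⟩, k, rfl⟩ := ha
    refine Finset.mem_image.2 ⟨k, Finset.mem_Icc.2 ⟨Nat.pos_of_mul_pos_left h1, ?_⟩, rfl⟩
    exact (Nat.le_mul_of_pos_left k hq).trans h2
  refine h.trans ?_
  rw [Finset.sum_image fun _ _ _ _ hxy => Nat.eq_of_mul_eq_mul_left hq hxy]
  simp only [Nat.cast_mul, mul_inv, ← Finset.mul_sum]
  exact mul_le_mul_of_nonneg_left (sum_Icc_inv_le r) (by positivity)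

/-- Multiplication by `a₀` permutes the residues mod `q`, so each block of `q` consecutive `a` meets
every nonzero residue at most once. -/
theorem sum_residue_le {q a₀ : ℕ} (hq : 0 < q) (hc : a₀.Coprime q) (r : ℕ) {f : ℕ → ℝ}
    (hf : ∀ s ∈ Finset.Ico 1 q, 0 ≤ f s) :
    ∑ a ∈ (Finset.Ioc 0 r).filter (¬ q ∣ ·), f (a * a₀ % q) ≤
      ((r / q : ℕ) + 1 : ℝ) * ∑ s ∈ Finset.Ico 1 q, f s := by
  have hinj : Set.InjOn (fun a => (a / q, a * a₀ % q))
      ((Finset.Ioc 0 r).filter (¬ q ∣ ·) : Finset ℕ) := by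
    intro a _ b _ hab
    simp only [Prod.mk.injEq] at hab
    have h1 : a ≡ b [MOD q] :=
      Nat.ModEq.cancel_right_of_coprime (by rw [Nat.gcd_comm]; exact hc) hab.2
    rw [← Nat.div_add_mod a q, ← Nat.div_add_mod b q, hab.1, h1]
  have hsub : ((Finset.Ioc 0 r).filter (¬ q ∣ ·)).image (fun a => (a / q, a * a₀ % q)) ⊆
      Finset.range (r / q + 1) ×ˢ Finset.Ico 1 q := by
    intro x hx
    obtain ⟨a, ha, rfl⟩ := Finset.mem_image.1 hx
    simp only [Finset.mem_filter, Finset.mem_Ioc] at ha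
    simp only [Finset.mem_product, Finset.mem_range, Finset.mem_Ico]
    refine ⟨Nat.lt_succ_of_le (Nat.div_le_div_right ha.1.2), ?_, Nat.mod_lt _ hq⟩
    rw [Nat.one_le_iff_ne_zero]
    intro h
    exact ha.2 (hc.symm.dvd_of_dvd_mul_right (Nat.dvd_of_mod_eq_zero h))
  calc ∑ a ∈ (Finset.Ioc 0 r).filter (¬ q ∣ ·), f (a * a₀ % q)
      = ∑ x ∈ ((Finset.Ioc 0 r).filter (¬ q ∣ ·)).image (fun a => (a / q, a * a₀ % q)),
          f x.2 := (Finset.sum_image (f := fun x : ℕ × ℕ => f x.2) hinj).symm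
    _ ≤ ∑ x ∈ Finset.range (r / q + 1) ×ˢ Finset.Ico 1 q, f x.2 :=
        Finset.sum_le_sum_of_subset_of_nonneg hsub fun x hx _ =>
          hf _ (Finset.mem_product.1 hx).2
    _ = _ := by
        rw [Finset.sum_product]
        simp

theorem sum_inv_add_inv_sub_le (q : ℕ) :
    ∑ s ∈ Finset.Ico 1 q, (((s : ℝ))⁻¹ + ((q : ℝ) - s)⁻¹) ≤ 2 * (1 + Real.log q) := by
  have h1 : ∑ s ∈ Finset.Ico 1 q, ((q : ℝ) - s)⁻¹ = ∑ s ∈ Finset.Ico 1 q, ((s : ℝ))⁻¹ := by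
    refine Finset.sum_bij' (fun s _ => q - s) (fun s _ => q - s) ?_ ?_ ?_ ?_ ?_
    all_goals intro s hs; simp only [Finset.mem_Ico] at hs ⊢
    · omega
    · omega
    · omega
    · omega
    · rw [Nat.cast_sub hs.2.le]
  have h2 : ∑ s ∈ Finset.Ico 1 q, ((s : ℝ))⁻¹ ≤ ∑ s ∈ Finset.Icc 1 q, ((s : ℝ))⁻¹ :=
    Finset.sum_le_sum_of_subset_of_nonneg Finset.Ico_subset_Icc_self fun _ _ _ => by positivity
  have h3 := sum_Icc_inv_le q
  rw [Finset.sum_add_distrib, h1]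
  linarith

/-- With `s = n % q`, the fraction `n/q` is at least `s/q` or `(q - s)/q` from `k`, according to the
side on which `k` lies. Moving to `θ` costs `1/(2q)`, at most half of this. Adding both inverses
covers either side. -/
theorem le_of_mul_abs_sub_le {q n : ℕ} (hq : 0 < q) (hn : ¬ q ∣ n) {θ T : ℝ} (hT : 0 ≤ T)
    {k : ℤ} (hθ : |θ - n / q| ≤ 1 / (2 * q)) (h : T * |θ - k| ≤ 1 / 2) :
    T ≤ q * ((((n % q : ℕ) : ℝ))⁻¹ + ((q : ℝ) - (n % q : ℕ))⁻¹) := by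
  have hq' : (0 : ℝ) < q := by exact_mod_cast hq
  set s := n % q with hs
  have hs1 : 1 ≤ s := Nat.one_le_iff_ne_zero.2 fun h0 => hn (Nat.dvd_of_mod_eq_zero h0)
  have hs2 : s + 1 ≤ q := Nat.mod_lt _ hq
  have hs1' : (1 : ℝ) ≤ s := by exact_mod_cast hs1
  have hs2' : (s : ℝ) + 1 ≤ q := by exact_mod_cast hs2
  have hdiv : (n : ℝ) = q * (n / q : ℕ) + s := by exact_mod_cast (Nat.div_add_mod n q).symm
  have hs0 : 0 ≤ ((s : ℝ))⁻¹ := by positivity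
  have hs0' : 0 ≤ ((q : ℝ) - s)⁻¹ := inv_nonneg.2 (by linarith)
  obtain ⟨t, ht⟩ : ∃ t, n / q = t := ⟨_, rfl⟩
  rw [ht] at hdiv
  have e1 : (n : ℝ) / q = t + s / q := by
    rw [hdiv]
    field_simp
  have e2 : (1 : ℝ) / (2 * q) * (2 * q) = 1 := by field_simp
  have e3 : (s : ℝ) / q * q = s := by field_simp
  -- a lower bound `u / (2 q)` for the distance gives `T ≤ q / u`
  have fin : ∀ u : ℝ, 1 ≤ u → u ≤ |θ - k| * (2 * q) → T ≤ q * u⁻¹ := by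
    intro u hu hle
    have h5 := mul_le_mul_of_nonneg_left hle hT
    rw [← div_eq_mul_inv, le_div_iff₀ (by linarith)]
    nlinarith
  rcases le_or_gt k (t : ℤ) with hk | hk
  · have hk' : (k : ℝ) ≤ t := by exact_mod_cast hk
    have h6 : (s : ℝ) / q - 1 / (2 * q) ≤ |θ - k| := by
      have := (abs_le.1 hθ).1
      refine le_trans ?_ (le_abs_self _)
      linarith
    have h7 := fin s hs1' (by nlinarith)
    nlinarith
  · have hk' : (t : ℝ) + 1 ≤ k := by exact_mod_cast hk
    have h6 : 1 - (s : ℝ) / q - 1 / (2 * q) ≤ |θ - k| := by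
      have := (abs_le.1 hθ).2
      refine le_trans ?_ (neg_le_abs _)
      linarith
    have h7 := fin (q - s) (by linarith) (by nlinarith)
    nlinarith

/-- The bound for the divisor sum near a reduced fraction `a₀ / q`. -/
theorem norm_expSum_tau_le_of_near {X α : ℝ} {q a₀ : ℕ} (hq : 0 < q) (hc : a₀.Coprime q)
    (hqr : q ≤ 2 * ⌊X⌋₊.sqrt)
    (hα : |α - a₀ / q| ≤ 1 / ((2 * ⌊X⌋₊.sqrt + 1) * q)) :
    ‖expSum (fun n => (tau n : ℂ)) X α‖ ≤
      3 * (1 + Real.log ⌊X⌋₊.sqrt) * (⌊X⌋₊ / (q * (1 + ⌊X⌋₊ * |α - a₀ / q|))) +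
      12 * (1 + Real.log (2 * ⌊X⌋₊.sqrt)) * ⌊X⌋₊.sqrt := by
  set Y := ⌊X⌋₊
  set r := Y.sqrt with hr
  set δ := |α - a₀ / q| with hδ
  have hδ0 : 0 ≤ δ := abs_nonneg _
  have hq' : (0 : ℝ) < q := by exact_mod_cast hq
  have hr0 : 0 < r := by omega
  have hr' : (0 : ℝ) < r := by exact_mod_cast hr0
  have hY0 : (0 : ℝ) ≤ Y := by positivity
  have hden : 0 < 1 + Y * δ := by positivity
  have hclose : ∀ a ∈ Finset.Ioc 0 r, |(a : ℝ) * α - (a * a₀ : ℕ) / q| ≤ 1 / (2 * q) ∧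
      |(a : ℝ) * α - (a * a₀ : ℕ) / q| = a * δ := by
    intro a ha
    have ha' : (a : ℝ) ≤ r := by exact_mod_cast (Finset.mem_Ioc.1 ha).2
    have h1 : |(a : ℝ) * α - (a * a₀ : ℕ) / q| = a * δ := by
      rw [hδ, ← abs_of_nonneg (Nat.cast_nonneg (α := ℝ) a), ← abs_mul,
        abs_of_nonneg (Nat.cast_nonneg (α := ℝ) a)]
      congr 1
      push_cast
      ring
    refine ⟨?_, h1⟩
    rw [h1]
    -- The Dirichlet quality `2r + 1` is what keeps every multiple with `a ≤ r` this close.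
    calc (a : ℝ) * δ ≤ r * (1 / ((2 * r + 1) * q)) := by gcongr
      _ ≤ 1 / (2 * q) := by
        rw [mul_one_div, div_le_div_iff₀ (by positivity) (by positivity)]
        nlinarith
  let B : ℕ → ℝ := fun a => if q ∣ a then 3 / 2 * (Y / (1 + Y * δ)) * ((a : ℝ))⁻¹ else
    q * ((((a * a₀ % q : ℕ) : ℝ))⁻¹ + ((q : ℝ) - (a * a₀ % q : ℕ))⁻¹)
  have hB : ∀ a ∈ Finset.Ioc 0 r, ∀ m, 1 ≤ m →
      ‖∑ b ∈ Finset.Ico m (Y / a + 1), e ((b : ℝ) * (a * α))‖ ≤ B a := by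
    intro a ha m hm
    have ha0 : (0 : ℝ) < a := by exact_mod_cast (Finset.mem_Ioc.1 ha).1
    obtain ⟨h1, h2⟩ := hclose a ha
    by_cases hd : q ∣ a
    · simp only [B, if_pos hd]
      obtain ⟨k, rfl⟩ := hd
      have h3 := (norm_sum_Ico_e_le hm (Y / (q * k)) (((q * k : ℕ) : ℝ) * α)).trans
        Nat.cast_div_le
      have h4 : (((q * k * a₀ : ℕ) : ℝ)) / q = ((k * a₀ : ℕ) : ℤ) := by
        push_cast
        field_simp
      have h5 : (1 : ℝ) / (2 * q) ≤ 1 / 2 := by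
        have : (1 : ℝ) ≤ q := by exact_mod_cast hq
        apply one_div_le_one_div_of_le <;> linarith
      rw [h4] at h1 h2
      have h6 := norm_sum_Ico_e_mul_abs_le m (Y / (q * k) + 1) _ _ (h1.trans h5)
      rw [h2] at h6
      rw [le_div_iff₀ ha0] at h3
      -- Writing `T` for the norm, `T a ≤ Y` plus `Y` times `T a δ ≤ 1/2` gives `T a (1 + Yδ) ≤
      -- 3Y/2`.
      rw [← div_eq_mul_inv, le_div_iff₀ ha0, ← mul_div_assoc, le_div_iff₀ hden]
      nlinarith
    · simp only [B, if_neg hd]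
      have hnd : ¬ q ∣ a * a₀ := fun h => hd (hc.symm.dvd_of_dvd_mul_right h)
      exact le_of_mul_abs_sub_le hq hnd (norm_nonneg _) h1
        (norm_sum_Ico_e_mul_abs_le m _ _ (round ((a : ℝ) * α)) (abs_sub_round _))
  have hfar : ∑ a ∈ (Finset.Ioc 0 r).filter (¬ q ∣ ·), B a ≤
      6 * r * (1 + Real.log (2 * r)) := by
    have h1 : ∑ a ∈ (Finset.Ioc 0 r).filter (¬ q ∣ ·), B a =
        ∑ a ∈ (Finset.Ioc 0 r).filter (¬ q ∣ ·),
          (fun s : ℕ => (q : ℝ) * (((s : ℝ))⁻¹ + ((q : ℝ) - s)⁻¹)) (a * a₀ % q) :=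
      Finset.sum_congr rfl fun a ha => if_neg (Finset.mem_filter.1 ha).2
    rw [h1]
    refine (sum_residue_le (f := fun s : ℕ => (q : ℝ) * (((s : ℝ))⁻¹ + ((q : ℝ) - s)⁻¹)) hq hc r
      ?_).trans ?_
    · intro s hs
      have : (s : ℝ) < q := by exact_mod_cast (Finset.mem_Ico.1 hs).2
      have := inv_nonneg.2 (sub_nonneg.2 this.le)
      positivity
    · rw [← Finset.mul_sum]
      have h2 := sum_inv_add_inv_sub_le q
      -- Uses `q ≤ 2r`.
      have h3 : ((r / q : ℕ) + 1 : ℝ) * q ≤ 3 * r := by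
        exact_mod_cast (by have := Nat.div_mul_le_self r q; linarith : (r / q + 1) * q ≤ 3 * r)
      have h4 : Real.log q ≤ Real.log (2 * r) :=
        Real.log_le_log hq' (by exact_mod_cast hqr)
      have h5 : 0 ≤ Real.log q := Real.log_natCast_nonneg q
      calc _ ≤ ((r / q : ℕ) + 1 : ℝ) * (q * (2 * (1 + Real.log q))) := by gcongr
        _ = ((r / q : ℕ) + 1 : ℝ) * q * (2 * (1 + Real.log q)) := by ring
        _ ≤ 3 * r * (2 * (1 + Real.log (2 * r))) := by gcongr
        _ = _ := by ring
  have hnear : ∑ a ∈ (Finset.Ioc 0 r).filter (q ∣ ·), B a ≤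
      3 / 2 * (Y / (1 + Y * δ)) * ((q : ℝ)⁻¹ * (1 + Real.log r)) := by
    have h1 : ∑ a ∈ (Finset.Ioc 0 r).filter (q ∣ ·), B a =
        ∑ a ∈ (Finset.Ioc 0 r).filter (q ∣ ·), 3 / 2 * (Y / (1 + Y * δ)) * ((a : ℝ))⁻¹ :=
      Finset.sum_congr rfl fun a ha => if_pos (Finset.mem_filter.1 ha).2
    rw [h1, ← Finset.mul_sum]
    exact mul_le_mul_of_nonneg_left (sum_multiples_inv_le hq r) (by positivity)
  have hsplit := Finset.sum_filter_add_sum_filter_not (Finset.Ioc 0 r) (q ∣ ·) B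
  have hmain := norm_expSum_tau_le hB
  have heq : 3 * (1 + Real.log r) * (Y / (q * (1 + Y * δ))) =
      2 * (3 / 2 * (Y / (1 + Y * δ)) * ((q : ℝ)⁻¹ * (1 + Real.log r))) := by
    field_simp
  rw [heq]
  linarith

/-! ### The lower bound. -/

theorem continuous_norm_expSum_rpow (f : ℕ → ℂ) (X : ℝ) {p : ℝ} (hp : 0 ≤ p) :
    Continuous fun α => ‖expSum f X α‖ ^ p := by
  have h : Continuous fun α => expSum f X α := by
    unfold expSum
    refine continuous_finsetSum _ fun n _ => ?_
    exact continuous_const.mul (continuous_e.comp (continuous_const.mul continuous_id))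
  exact h.norm.rpow_const fun _ => Or.inr hp

/-- Since `⌊y⌋ ≥ y/2` for `y ≥ 1`, half of `X` times a harmonic sum survives. -/
theorem mul_log_le_sum_tau {X : ℝ} (hX : 1 ≤ X) :
    X * Real.log X / 2 ≤ ∑ n ∈ Finset.Icc 1 ⌊X⌋₊, (tau n : ℝ) := by
  have h := sum_tau_mul (R := ℝ) (fun _ => 1) ⌊X⌋₊
  simp only [mul_one] at h
  rw [h]
  have h1 : ∑ a ∈ Finset.Icc 1 ⌊X⌋₊, X / 2 * ((a : ℝ))⁻¹ ≤
      ∑ a ∈ Finset.Ioc 0 ⌊X⌋₊, ∑ _b ∈ Finset.Ico 1 (⌊X⌋₊ / a + 1), (1 : ℝ) := by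
    refine Finset.sum_le_sum fun a ha => ?_
    obtain ⟨ha1, ha2⟩ := Finset.mem_Icc.1 ha
    have ha0 : (0 : ℝ) < a := by exact_mod_cast ha1
    have hfl : ⌊X⌋₊ / a = ⌊X / a⌋₊ := (Nat.floor_div_natCast X a).symm
    have h2 : 1 ≤ X / a := by
      rw [le_div_iff₀ ha0, one_mul]
      exact (Nat.le_floor_iff (by linarith)).1 ha2
    have h3 := Nat.lt_floor_add_one (X / a)
    have h4 : (1 : ℝ) ≤ ⌊X / a⌋₊ := by exact_mod_cast (Nat.one_le_floor_iff _).2 h2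
    simp only [Finset.sum_const, Nat.card_Ico, add_tsub_cancel_right, nsmul_eq_mul, mul_one]
    rw [hfl]
    have h5 : X / 2 * ((a : ℝ))⁻¹ = X / a / 2 := by ring
    linarith
  refine le_trans ?_ h1
  rw [← Finset.mul_sum]
  have h2 := mul_le_mul_of_nonneg_left (log_le_sum_Icc_inv (by linarith : 0 < X))
    (by linarith : 0 ≤ X / 2)
  linarith

theorem re_e (x : ℝ) : (e x).re = Real.cos (2 * Real.pi * x) := by
  rw [e_eq_exp, mul_comm, Complex.exp_ofReal_mul_I_re]

/-- Here `nα ≤ 1/6`, so each `cos(2πnα)` is at least `cos(π/3) = 1/2`. -/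
theorem mul_log_le_norm_expSum_tau {X α : ℝ} (hX : 1 ≤ X) (h0 : 0 ≤ α) (h1 : α ≤ 1 / (6 * X)) :
    X * Real.log X / 4 ≤ ‖expSum (fun n => (tau n : ℂ)) X α‖ := by
  refine le_trans ?_ (Complex.re_le_norm _)
  unfold expSum
  rw [Complex.re_sum]
  have h2 : ∑ n ∈ Finset.Icc 1 ⌊X⌋₊, (tau n : ℝ) * (1 / 2) ≤
      ∑ n ∈ Finset.Icc 1 ⌊X⌋₊, ((tau n : ℂ) * e ((n : ℝ) * α)).re := by
    refine Finset.sum_le_sum fun n hn => ?_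
    have hn' : (n : ℝ) ≤ X := (Nat.le_floor_iff (by linarith)).1 (Finset.mem_Icc.1 hn).2
    have h3 : (n : ℝ) * α ≤ 1 / 6 := by
      calc (n : ℝ) * α ≤ X * (1 / (6 * X)) := by gcongr
        _ = 1 / 6 := by field_simp
    have h4 : 0 ≤ (n : ℝ) * α := by positivity
    have hpi := Real.pi_pos
    rw [← Complex.ofReal_natCast, Complex.re_ofReal_mul, re_e]
    refine mul_le_mul_of_nonneg_left ?_ (Nat.cast_nonneg _)
    rw [← Real.cos_pi_div_three]
    exact Real.cos_le_cos_of_nonneg_of_le_pi (by positivity) (by linarith) (by nlinarith)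
  rw [← Finset.sum_mul] at h2
  have h3 := mul_log_le_sum_tau hX
  linarith

theorem le_moment_tau {X p : ℝ} (hX : 1 ≤ X) (hp : 0 ≤ p) :
    1 / 6 * (1 / 4) ^ p * (X ^ (p - 1) * Real.log X ^ p) ≤
      moment (fun n => (tau n : ℂ)) X p := by
  have hX0 : 0 < X := by linarith
  have hlog := Real.log_nonneg hX
  have hcont := continuous_norm_expSum_rpow (fun n => (tau n : ℂ)) X hp
  have hle : 1 / (6 * X) ≤ 1 := by
    rw [div_le_one (by positivity)]
    linarith
  calc 1 / 6 * (1 / 4) ^ p * (X ^ (p - 1) * Real.log X ^ p)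
      = ∫ _α in (0 : ℝ)..1 / (6 * X), (X * Real.log X / 4) ^ p := by
        rw [intervalIntegral.integral_const, div_eq_mul_one_div (X * Real.log X),
          Real.mul_rpow (by positivity) (by norm_num), Real.mul_rpow hX0.le hlog,
          Real.rpow_sub_one hX0.ne', smul_eq_mul]
        field_simp
        ring
    _ ≤ ∫ α in (0 : ℝ)..1 / (6 * X), ‖expSum (fun n => (tau n : ℂ)) X α‖ ^ p :=
        intervalIntegral.integral_mono_on (by positivity) (by simp)
          (hcont.intervalIntegrable _ _) fun α hα =>
          Real.rpow_le_rpow (by positivity) (mul_log_le_norm_expSum_tau hX hα.1 hα.2) hp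
    _ ≤ moment (fun n => (tau n : ℂ)) X p :=
        intervalIntegral.integral_mono_interval le_rfl (by positivity) hle
          (Filter.Eventually.of_forall fun α => by positivity) (hcont.intervalIntegrable _ _)

/-! ### Dirichlet approximation and the upper bound. -/

theorem exists_coprime_near {α : ℝ} (h0 : 0 ≤ α) (h1 : α ≤ 1) {N : ℕ} (hN : 0 < N) :
    ∃ q a : ℕ, 0 < q ∧ q ≤ N ∧ a ≤ q ∧ a.Coprime q ∧ |α - a / q| ≤ 1 / ((N + 1) * q) := by
  obtain ⟨x, hx, hxN⟩ := Real.exists_rat_abs_sub_le_and_den_le α hN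
  have hd : (0 : ℝ) < x.den := by exact_mod_cast x.pos
  have hN' : (0 : ℝ) < N := by exact_mod_cast hN
  have hcast : (x : ℝ) = x.num / x.den := by exact_mod_cast (Rat.num_div_den x).symm
  -- Strictness forces the integer numerator into `[0, q]`.
  have hlt : |α * x.den - x.num| < 1 := by
    have h2 : α * x.den - x.num = (α - x) * x.den := by
      rw [hcast]
      field_simp
    rw [h2, abs_mul, abs_of_pos hd]
    calc |α - x| * x.den ≤ 1 / ((N + 1) * x.den) * x.den := by gcongr
      _ = 1 / (N + 1) := by field_simp
      _ < 1 := by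
        rw [div_lt_one (by positivity)]
        linarith
  obtain ⟨h2, h3⟩ := abs_lt.1 hlt
  have h4 : 0 ≤ x.num := by
    have : (-1 : ℝ) < x.num := by nlinarith
    have : -1 < x.num := by exact_mod_cast this
    omega
  have h5 : x.num ≤ x.den := by
    have : (x.num : ℝ) < x.den + 1 := by nlinarith
    have : x.num < x.den + 1 := by exact_mod_cast this
    omega
  have h6 : ((x.num.natAbs : ℕ) : ℝ) = x.num := by
    rw [Nat.cast_natAbs, abs_of_nonneg h4]
  refine ⟨x.den, x.num.natAbs, x.pos, hxN, by omega, x.reduced, ?_⟩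
  rw [h6, ← hcast]
  exact hx

theorem exists_norm_expSum_tau_le {X α : ℝ} (hX : 2 ≤ X) (h0 : 0 ≤ α) (h1 : α ≤ 1) :
    ∃ q ∈ Finset.Icc 1 (2 * ⌊X⌋₊.sqrt), ∃ a ∈ Finset.range (q + 1),
      ‖expSum (fun n => (tau n : ℂ)) X α‖ ≤
        48 * Real.log X * (⌊X⌋₊ / (q * (1 + ⌊X⌋₊ * |α - a / q|)) + ⌊X⌋₊.sqrt) := by
  have hr0 : 0 < ⌊X⌋₊.sqrt := Nat.sqrt_pos.2 (Nat.floor_pos.2 (by linarith))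
  obtain ⟨q, a, hq, hqN, haq, hc, hα⟩ := exists_coprime_near h0 h1
    (by omega : 0 < 2 * ⌊X⌋₊.sqrt)
  push_cast at hα
  refine ⟨q, Finset.mem_Icc.2 ⟨hq, hqN⟩, a, Finset.mem_range.2 (Nat.lt_succ_of_le haq),
    (norm_expSum_tau_le_of_near hq hc hqN hα).trans ?_⟩
  have hr1 : (1 : ℝ) ≤ ⌊X⌋₊.sqrt := by exact_mod_cast hr0
  have hrX : (⌊X⌋₊.sqrt : ℝ) ≤ X :=
    le_trans (by exact_mod_cast Nat.sqrt_le_self _) (Nat.floor_le (by linarith))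
  have hl2 := Real.log_two_gt_d9
  have hlX : Real.log 2 ≤ Real.log X := Real.log_le_log (by norm_num) hX
  have hlr : Real.log ⌊X⌋₊.sqrt ≤ Real.log X := Real.log_le_log (by linarith) hrX
  have hl2r : Real.log (2 * ⌊X⌋₊.sqrt) ≤ 2 * Real.log X := by
    rw [Real.log_mul (by norm_num) (by positivity)]
    linarith
  rw [mul_add (48 * Real.log X)]
  refine add_le_add ?_ ?_ <;> refine mul_le_mul_of_nonneg_right ?_ (by positivity) <;> linarith

theorem integral_inv_one_add_sq_le {Y : ℝ} (hY : 0 < Y) (x a b : ℝ) :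
    ∫ α in a..b, (1 + (Y * α - x) ^ 2)⁻¹ ≤ Real.pi / Y := by
  rw [intervalIntegral.integral_comp_mul_sub (fun t : ℝ => (1 + t ^ 2)⁻¹) hY.ne',
    integral_inv_one_add_sq, smul_eq_mul, div_eq_inv_mul]
  have h1 := Real.arctan_lt_pi_div_two (Y * b - x)
  have h2 := Real.neg_pi_div_two_lt_arctan (Y * a - x)
  exact mul_le_mul_of_nonneg_left (by linarith) (by positivity)

/-- Trades the peak for an arctangent derivative, whose integral is bounded uniformly. -/
theorem div_rpow_le {Y q δ p : ℝ} (hY : 0 ≤ Y) (hq : 0 < q) (hδ : 0 ≤ δ) (hp : 2 ≤ p) :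
    (Y / (q * (1 + Y * δ))) ^ p ≤ Y ^ p * q ^ (-p) * (1 + (Y * δ) ^ 2)⁻¹ := by
  have h0 : 0 ≤ Y * δ := mul_nonneg hY hδ
  have h1 : 1 + (Y * δ) ^ 2 ≤ (1 + Y * δ) ^ p := by
    calc 1 + (Y * δ) ^ 2 ≤ (1 + Y * δ) ^ (2 : ℕ) := by nlinarith
      _ = (1 + Y * δ) ^ (2 : ℝ) := (Real.rpow_natCast _ 2).symm
      _ ≤ (1 + Y * δ) ^ p := Real.rpow_le_rpow_of_exponent_le (by linarith) hp
  rw [Real.div_rpow hY (by positivity), Real.mul_rpow hq.le (by positivity), Real.rpow_neg hq.le,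
    div_eq_mul_inv, mul_inv, mul_assoc]
  gcongr

theorem add_rpow_le_mul_rpow_add_rpow {x y p : ℝ} (hx : 0 ≤ x) (hy : 0 ≤ y) (hp : 1 ≤ p) :
    (x + y) ^ p ≤ 2 ^ (p - 1) * (x ^ p + y ^ p) := by
  lift x to NNReal using hx
  lift y to NNReal using hy
  exact_mod_cast NNReal.rpow_add_le_mul_rpow_add_rpow x y hp

/-- The approximating fraction depends on `α`; summing the nonnegative peaks over all fractions
gives an integrable majorant. -/
theorem norm_expSum_tau_rpow_le {X α p : ℝ} (hX : 2 ≤ X) (hp : 2 ≤ p) (h0 : 0 ≤ α) (h1 : α ≤ 1) :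
    ‖expSum (fun n => (tau n : ℂ)) X α‖ ^ p ≤
      (48 * Real.log X) ^ p * 2 ^ (p - 1) * ((⌊X⌋₊.sqrt : ℝ) ^ p +
        ∑ q ∈ Finset.Icc 1 (2 * ⌊X⌋₊.sqrt), ∑ a ∈ Finset.range (q + 1),
          (⌊X⌋₊ : ℝ) ^ p * (q : ℝ) ^ (-p) * (1 + (⌊X⌋₊ * α - ⌊X⌋₊ * (a / q)) ^ 2)⁻¹) := by
  obtain ⟨q, hq, a, ha, h⟩ := exists_norm_expSum_tau_le hX h0 h1
  have hq0 : (0 : ℝ) < q := by exact_mod_cast (Finset.mem_Icc.1 hq).1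
  have hlog : 0 ≤ Real.log X := Real.log_nonneg (by linarith)
  have h2 := div_rpow_le (Nat.cast_nonneg (α := ℝ) ⌊X⌋₊) hq0 (abs_nonneg (α - a / q)) hp
  rw [mul_pow, sq_abs, ← mul_pow, mul_sub] at h2
  have h3 : (⌊X⌋₊ : ℝ) ^ p * (q : ℝ) ^ (-p) * (1 + (⌊X⌋₊ * α - ⌊X⌋₊ * (a / q)) ^ 2)⁻¹ ≤
      ∑ q ∈ Finset.Icc 1 (2 * ⌊X⌋₊.sqrt), ∑ a ∈ Finset.range (q + 1),
          (⌊X⌋₊ : ℝ) ^ p * (q : ℝ) ^ (-p) * (1 + (⌊X⌋₊ * α - ⌊X⌋₊ * (a / q)) ^ 2)⁻¹ := by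
    refine le_trans ?_ (Finset.single_le_sum (f := fun q : ℕ => ∑ a ∈ Finset.range (q + 1),
          (⌊X⌋₊ : ℝ) ^ p * (q : ℝ) ^ (-p) * (1 + (⌊X⌋₊ * α - ⌊X⌋₊ * (a / q)) ^ 2)⁻¹)
          (fun _ _ => by positivity) hq)
    exact Finset.single_le_sum (f := fun a : ℕ =>
          (⌊X⌋₊ : ℝ) ^ p * (q : ℝ) ^ (-p) * (1 + (⌊X⌋₊ * α - ⌊X⌋₊ * (a / q)) ^ 2)⁻¹)
          (fun _ _ => by positivity) ha
  refine (Real.rpow_le_rpow (norm_nonneg _) h (by linarith)).trans ?_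
  rw [Real.mul_rpow (by positivity) (by positivity), mul_assoc]
  refine mul_le_mul_of_nonneg_left ?_ (by positivity)
  refine (add_rpow_le_mul_rpow_add_rpow (by positivity) (by positivity)
    (by linarith)).trans ?_
  exact mul_le_mul_of_nonneg_left (by linarith) (by positivity)

theorem moment_tau_le {X p : ℝ} (hX : 2 ≤ X) (hp : 2 < p) :
    moment (fun n => (tau n : ℂ)) X p ≤
      48 ^ p * 2 ^ (p - 1) * (1 + 2 * Real.pi * ∑' q : ℕ, (q : ℝ) ^ (1 - p)) *
        (X ^ (p - 1) * Real.log X ^ p) := by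
  have hlog : 0 ≤ Real.log X := Real.log_nonneg (by linarith)
  have hX0 : 0 < X := by linarith
  have hY : (0 : ℝ) < ⌊X⌋₊ := by exact_mod_cast Nat.floor_pos.2 (by linarith)
  have hYX : (⌊X⌋₊ : ℝ) ≤ X := Nat.floor_le hX0.le
  have hterm : ∀ q a : ℕ, Continuous fun α : ℝ => (⌊X⌋₊ : ℝ) ^ p * (q : ℝ) ^ (-p) *
      (1 + (⌊X⌋₊ * α - ⌊X⌋₊ * ((a : ℝ) / q)) ^ 2)⁻¹ := by
    intro q a
    exact continuous_const.mul (Continuous.inv₀ (by fun_prop) fun α => by positivity)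
  have hsum : ∀ q : ℕ, Continuous fun α : ℝ => ∑ a ∈ Finset.range (q + 1),
      (⌊X⌋₊ : ℝ) ^ p * (q : ℝ) ^ (-p) * (1 + (⌊X⌋₊ * α - ⌊X⌋₊ * ((a : ℝ) / q)) ^ 2)⁻¹ :=
    fun q => continuous_finsetSum _ fun a _ => hterm q a
  have hsum' : Continuous fun α : ℝ => ∑ q ∈ Finset.Icc 1 (2 * ⌊X⌋₊.sqrt),
      ∑ a ∈ Finset.range (q + 1), (⌊X⌋₊ : ℝ) ^ p * (q : ℝ) ^ (-p) *
        (1 + (⌊X⌋₊ * α - ⌊X⌋₊ * ((a : ℝ) / q)) ^ 2)⁻¹ :=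
    continuous_finsetSum _ fun q _ => hsum q
  -- The error term is affordable because `p/2 ≤ p - 1`.
  have hroot : (⌊X⌋₊.sqrt : ℝ) ^ p ≤ X ^ (p - 1) := by
    have h1 : (⌊X⌋₊.sqrt : ℝ) ≤ X ^ (1 / 2 : ℝ) := by
      rw [← Real.sqrt_eq_rpow]
      refine Real.le_sqrt_of_sq_le (le_trans ?_ hYX)
      exact_mod_cast Nat.sqrt_le' _
    calc (⌊X⌋₊.sqrt : ℝ) ^ p ≤ (X ^ (1 / 2 : ℝ)) ^ p := by gcongr
      _ = X ^ (1 / 2 * p) := (Real.rpow_mul hX0.le _ _).symm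
      _ ≤ X ^ (p - 1) := Real.rpow_le_rpow_of_exponent_le (by linarith) (by linarith)
  have hinner : ∀ q ∈ Finset.Icc 1 (2 * ⌊X⌋₊.sqrt), ∑ a ∈ Finset.range (q + 1),
      ∫ α in (0 : ℝ)..1, (⌊X⌋₊ : ℝ) ^ p * (q : ℝ) ^ (-p) *
        (1 + (⌊X⌋₊ * α - ⌊X⌋₊ * ((a : ℝ) / q)) ^ 2)⁻¹ ≤
      2 * Real.pi * X ^ (p - 1) * (q : ℝ) ^ (1 - p) := by
    intro q hq
    have hq1 : (1 : ℝ) ≤ q := by exact_mod_cast (Finset.mem_Icc.1 hq).1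
    calc _ ≤ ∑ _a ∈ Finset.range (q + 1),
          (⌊X⌋₊ : ℝ) ^ p * (q : ℝ) ^ (-p) * (Real.pi / ⌊X⌋₊) := by
          refine Finset.sum_le_sum fun a _ => ?_
          rw [intervalIntegral.integral_const_mul]
          exact mul_le_mul_of_nonneg_left (integral_inv_one_add_sq_le hY _ _ _) (by positivity)
      _ = (q + 1) * (Real.pi * (⌊X⌋₊ : ℝ) ^ (p - 1) * (q : ℝ) ^ (-p)) := by
          rw [Finset.sum_const, Finset.card_range, nsmul_eq_mul, Real.rpow_sub_one hY.ne']
          push_cast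
          ring
      _ ≤ (2 * q) * (Real.pi * X ^ (p - 1) * (q : ℝ) ^ (-p)) := by
          have := Real.pi_pos
          have := Real.rpow_le_rpow hY.le hYX (by linarith : 0 ≤ p - 1)
          gcongr
          linarith
      _ = _ := by
          rw [sub_eq_add_neg 1 p, Real.rpow_add (by linarith), Real.rpow_one]
          ring
  have htsum : ∑ q ∈ Finset.Icc 1 (2 * ⌊X⌋₊.sqrt), (q : ℝ) ^ (1 - p) ≤
      ∑' q : ℕ, (q : ℝ) ^ (1 - p) :=
    (Real.summable_nat_rpow.2 (by linarith)).sum_le_tsum _ fun _ _ => by positivity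
  calc moment (fun n => (tau n : ℂ)) X p
      ≤ ∫ α in (0 : ℝ)..1, (48 * Real.log X) ^ p * 2 ^ (p - 1) * ((⌊X⌋₊.sqrt : ℝ) ^ p +
        ∑ q ∈ Finset.Icc 1 (2 * ⌊X⌋₊.sqrt), ∑ a ∈ Finset.range (q + 1),
          (⌊X⌋₊ : ℝ) ^ p * (q : ℝ) ^ (-p) * (1 + (⌊X⌋₊ * α - ⌊X⌋₊ * ((a : ℝ) / q)) ^ 2)⁻¹) :=
        intervalIntegral.integral_mono_on zero_le_one
          ((continuous_norm_expSum_rpow _ X (by linarith)).intervalIntegrable _ _)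
          ((continuous_const.mul (continuous_const.add hsum')).intervalIntegrable _ _)
          fun α hα => norm_expSum_tau_rpow_le hX hp.le hα.1 hα.2
    _ = (48 * Real.log X) ^ p * 2 ^ (p - 1) * ((⌊X⌋₊.sqrt : ℝ) ^ p +
        ∑ q ∈ Finset.Icc 1 (2 * ⌊X⌋₊.sqrt), ∑ a ∈ Finset.range (q + 1),
          ∫ α in (0 : ℝ)..1, (⌊X⌋₊ : ℝ) ^ p * (q : ℝ) ^ (-p) *
            (1 + (⌊X⌋₊ * α - ⌊X⌋₊ * ((a : ℝ) / q)) ^ 2)⁻¹) := by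
        rw [intervalIntegral.integral_const_mul, intervalIntegral.integral_add
          (continuous_const.intervalIntegrable _ _) (hsum'.intervalIntegrable _ _),
          intervalIntegral.integral_const,
          intervalIntegral.integral_finsetSum fun q _ => (hsum q).intervalIntegrable _ _]
        congr 2
        · simp
        · exact Finset.sum_congr rfl fun q _ => intervalIntegral.integral_finsetSum
            fun a _ => (hterm q a).intervalIntegrable _ _
    _ ≤ (48 * Real.log X) ^ p * 2 ^ (p - 1) * (X ^ (p - 1) +
        2 * Real.pi * X ^ (p - 1) * ∑' q : ℕ, (q : ℝ) ^ (1 - p)) := by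
        have := Real.pi_pos
        refine mul_le_mul_of_nonneg_left (add_le_add hroot
          ((Finset.sum_le_sum hinner).trans ?_)) (by positivity)
        rw [← Finset.mul_sum]
        gcongr
    _ = _ := by
        rw [Real.mul_rpow (by norm_num) hlog]
        ring

theorem theorem1 (p : ℝ) (hp : 2 < p) :
    ∃ c C : ℝ, 0 < c ∧ 0 < C ∧ ∀ X : ℝ, 2 ≤ X →
      c * (X ^ (p - 1) * Real.log X ^ p) ≤ moment (fun n => (tau n : ℂ)) X p ∧
      moment (fun n => (tau n : ℂ)) X p ≤ C * (X ^ (p - 1) * Real.log X ^ p) := by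
  have hS : 0 ≤ ∑' q : ℕ, (q : ℝ) ^ (1 - p) := tsum_nonneg fun _ => by positivity
  have := Real.pi_pos
  exact ⟨1 / 6 * (1 / 4) ^ p,
    48 ^ p * 2 ^ (p - 1) * (1 + 2 * Real.pi * ∑' q : ℕ, (q : ℝ) ^ (1 - p)),
    by positivity, by positivity, fun X hX =>
      ⟨le_moment_tau (by linarith) (by linarith), moment_tau_le hX hp⟩⟩
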